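/- Let $n\ge 1$, let $\mathbb H$ be the skew field of real quaternions, and let $M(n,\mathbb H)$ be the ring of $n\times n$ matrices over $\mathbb H$; for $A=(a_{ij})\in M(n,\mathbb H)$ let $A^*=(\overline{a_{ji}})$, and let $A_{.j}(b)$ be the matrix obtained from $A$ by replacing its $j$th column with the column $b$. For $B=(b_{ij})\in M(n,\mathbb H)$ and $j\in\{1,\dots,n\}$ the $j$th column determinant is $$\mathrm{cdet}_j B=\sum_{\tau\in S_n}(-1)^{n-r}\,P_r\cdots P_2P_1,\qquad P_t=b_{c_t,\tau^{m_t-1}(c_t)}\cdots b_{\tau^2(c_t),\tau(c_t)}\,b_{\tau(c_t),c_t},$$ where $r$ is the number of cycles of $\tau$ (fixed points included), $c_1=j$, the elements $c_2<\dots<c_r$ are the smallest elements of the cycles of $\tau$ not containing $j$, and $m_t$ is the length of the cycle containing $c_t$. Likewise the $i$th row determinant is $$\mathrm{rdet}_i B=\sum_{\sigma\in S_n}(-1)^{n-r}\,Q_1Q_2\cdots Q_r,\qquad Q_t=b_{c_t,\sigma(c_t)}\,b_{\sigma(c_t),\sigma^2(c_t)}\cdots b_{\sigma^{m_t-1}(c_t),c_t},$$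 with $c_1=i$ and $r$, $c_t$, $m_t$ defined from $\sigma$ in the same way. For a Hermitian matrix all the row and column determinants coincide and are real; their common value is its determinant $\det$. The double determinant of $A$ is $\mathrm{ddet}\,A=\det(A^*A)$. **Theorem (Cramer's rule for a right system of linear equations).** Let $A\in M(n,\mathbb H)$ with $\mathrm{ddet}\,A\neq 0$, let $y=(y_1,\dots,y_n)^T\in\mathbb H^{n\times 1}$, and put $f=A^*y$. Then the right system of linear equations $A\cdot x=y$ has exactly one solution $x=(x_1,\dots,x_n)^T\in\mathbb H^{n\times 1}$, and for all $j=1,\dots,n$ $$x_j=\frac{\mathrm{cdet}_j\big((A^*A)_{.j}(f)\big)}{\mathrm{ddet}\,A}.$$ -/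

import Mathlib

open scoped Matrix Quaternion

namespace QuaternionCramer

variable {n : ℕ} {R : Type*} [Ring R]

/-- The elements that open the cycles of `σ` (fixed points count as cycles of length one), in the
order in which the cycles are listed: first `i`, for the cycle that contains `i`; then, in increasing
order, the smallest elements of the cycles that do not contain `i`. -/
def openers (σ : Equiv.Perm (Fin n)) (i : Fin n) : List (Fin n) :=
  i :: (List.finRange n).filter
    (fun c => ¬ σ.SameCycle i c ∧ ∀ d, σ.SameCycle c d → c ≤ d)

/-- The length of the cycle of `σ` through `c` (it is `1` when `c` is a fixed point). -/
def cycleLength (σ : Equiv.Perm (Fin n)) (c : Fin n) : ℕ :=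
  (Finset.univ.filter (fun d => σ.SameCycle c d)).card

/-- The product along the cycle of `σ` opened by `c`, read from left to right:
`a (c, σ c) * a (σ c, σ² c) * ⋯ * a (σ^(m-1) c, c)`, where `m` is the length of the cycle. -/
def rowCycleProd (A : Matrix (Fin n) (Fin n) R) (σ : Equiv.Perm (Fin n)) (c : Fin n) : R :=
  ((List.range (cycleLength σ c)).map (fun k => A ((σ ^ k) c) ((σ ^ (k + 1)) c))).prod

/-- The product along the cycle of `τ` opened by `c`, read from right to left:
`a (c, τ^(m-1) c) * ⋯ * a (τ² c, τ c) * a (τ c, c)`, where `m` is the length of the cycle. -/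
def colCycleProd (A : Matrix (Fin n) (Fin n) R) (τ : Equiv.Perm (Fin n)) (c : Fin n) : R :=
  ((List.range (cycleLength τ c)).reverse.map (fun k => A ((τ ^ (k + 1)) c) ((τ ^ k) c))).prod

/-- The `i`-th row determinant. In each monomial the cycle of `i` stands leftmost, and the other
cycles follow from left to right. The sign of `σ` is `(-1) ^ (n - r)`, where `r` is the number of
cycles of `σ`, fixed points included. -/
def rdet (i : Fin n) (A : Matrix (Fin n) (Fin n) R) : R :=
  ∑ σ : Equiv.Perm (Fin n),
    ((Equiv.Perm.sign σ : ℤ) : R) * ((openers σ i).map (rowCycleProd A σ)).prod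

/-- The `j`-th column determinant. In each monomial the cycle of `j` stands rightmost, and the other
cycles follow from right to left. -/
def cdet (j : Fin n) (A : Matrix (Fin n) (Fin n) R) : R :=
  ∑ τ : Equiv.Perm (Fin n),
    ((Equiv.Perm.sign τ : ℤ) : R) * ((openers τ j).reverse.map (colCycleProd A τ)).prod

/-- The determinant of a Hermitian quaternion matrix. For Hermitian `H` all the row determinants and
all the column determinants of `H` coincide, so the choice of the first row is immaterial. -/
noncomputable def hermDet [NeZero n] (H : Matrix (Fin n) (Fin n) ℍ[ℝ]) : ℍ[ℝ] :=
  rdet 0 H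

/-- The double determinant: the determinant of the Hermitian matrix `A* A`. -/
noncomputable def ddet [NeZero n] (A : Matrix (Fin n) (Fin n) ℍ[ℝ]) : ℍ[ℝ] :=
  hermDet (Aᴴ * A)

end QuaternionCramer

/-!
Write `H = Aᴴ * A`, a Hermitian matrix. The proof rests on two facts about a Hermitian `H`:
`cdet j H` is a real number that does not depend on `j` (and equals every row determinant), and
`cdet j` vanishes when the column `j` of `H` is replaced with a copy of another column. Since
`cdet j (H.updateCol j b)` is right linear in `b`, they give
`cdet j (H.updateCol j (H *ᵥ x)) = det H * x j` for every `x`, which is Cramer's rule without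
division (`cdet_updateCol_mulVec_self`). If `A *ᵥ x = y`, then `H *ᵥ x = Aᴴ *ᵥ y` and the formula for
`x` follows. The same identity exhibits a left inverse of `H`, hence of `A`; matrices over a division
ring being Dedekind finite, `A` is invertible, so a solution exists and must be the one given by the
formula.

Both facts come from reversing cycles. Replacing one cycle of a permutation with its inverse keeps the
sign and the set of cycles, and conjugates the product of the entries of `H` along this cycle
(`invertCycle`, `colCycleProd_invertCycle`). Averaging over such reversals replaces the product along
a cycle with its real part, as long as the cycle meets only columns of `H` that are untouched
(`cdet_updateCol_eq_sum`). As `re (a * b) = re (b * a)`, the real part does not depend on the element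
that opens the cycle, and so `cdet j H = realDet H` for all `j` (`cdet_eq_realDet`).

If the column `j` is a copy of the column `k`, the involution `σ ↦ σ * swap j k` changes the sign and
exchanges the permutations for which `j` and `k` share a cycle with the others. Merging two cycles
concatenates their products exactly (`colCycleProd_updateCol_mul_swap`); the only difference between
the two terms is that the product along the cycle of `k` appears in full in one and through its real
part in the other, which another reversal removes (`cdet_updateCol_eq_zero`).
-/

namespace QuaternionCramer

open Equiv Equiv.Perm

/-! ### Products in descending order -/

section DescProd

variable {R : Type*} [Monoid R]

/-- The product `f (m - 1) * ⋯ * f 1 * f 0`. -/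
def descProd (f : ℕ → R) (m : ℕ) : R := ((List.range m).reverse.map f).prod

theorem descProd_zero (f : ℕ → R) : descProd f 0 = 1 := by simp [descProd]

theorem descProd_succ (f : ℕ → R) (m : ℕ) : descProd f (m + 1) = f m * descProd f m := by
  simp [descProd, List.range_succ]

theorem descProd_add (f : ℕ → R) (a b : ℕ) :
    descProd f (a + b) = descProd (fun t => f (a + t)) b * descProd f a := by
  induction b with
  | zero => simp [descProd_zero]
  | succ b ih => rw [← add_assoc, descProd_succ, ih, descProd_succ, mul_assoc]

theorem descProd_succ' (f : ℕ → R) (m : ℕ) :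
    descProd f (m + 1) = descProd (fun t => f (t + 1)) m * f 0 := by
  rw [add_comm m 1, descProd_add, descProd_succ, descProd_zero, mul_one]
  simp only [add_comm 1]

theorem descProd_congr {f g : ℕ → R} {m : ℕ} (h : ∀ k < m, f k = g k) :
    descProd f m = descProd g m := by
  induction m with
  | zero => simp [descProd_zero]
  | succ m ih =>
    rw [descProd_succ, descProd_succ, h m m.lt_succ_self,
      ih fun k hk => h k (hk.trans m.lt_succ_self)]

theorem prod_map_range_eq_descProd (f : ℕ → R) (m : ℕ) :
    ((List.range m).map f).prod = descProd (fun k => f (m - 1 - k)) m := by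
  induction m with
  | zero => simp [descProd_zero]
  | succ m ih =>
    rw [List.range_succ, List.map_append, List.prod_append, ih, descProd_succ']
    simp only [List.map_cons, List.map_nil, List.prod_singleton, Nat.add_sub_cancel, Nat.sub_zero]
    congr 1
    exact descProd_congr fun k _ => congrArg f (by omega)

theorem star_descProd [StarMul R] (f : ℕ → R) (m : ℕ) :
    star (descProd f m) = ((List.range m).map fun k => star (f k)).prod := by
  induction m with
  | zero => simp [descProd_zero]
  | succ m ih => simp [descProd_succ, List.range_succ, ih]

end DescProd

/-! ### Cycles and their lengths -/

section Cycles

variable {n : ℕ}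

theorem pow_apply_eq_of_agree {f g : Perm (Fin n)} {x : Fin n}
    (h : ∀ y, g.SameCycle x y → f y = g y) (k : ℕ) : (f ^ k) x = (g ^ k) x := by
  induction k with
  | zero => rfl
  | succ k ih =>
    rw [pow_succ', pow_succ', mul_apply, mul_apply, ih, h _ (sameCycle_pow_right.2 .rfl)]

theorem sameCycle_iff_exists_pow {f : Perm (Fin n)} {x y : Fin n} :
    f.SameCycle x y ↔ ∃ k : ℕ, (f ^ k) x = y :=
  ⟨fun h => h.exists_nat_pow_eq, fun ⟨k, hk⟩ => ⟨k, by simpa using hk⟩⟩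

theorem sameCycle_iff_of_agree {f g : Perm (Fin n)} {x : Fin n}
    (h : ∀ y, g.SameCycle x y → f y = g y) (y : Fin n) : f.SameCycle x y ↔ g.SameCycle x y := by
  simp only [sameCycle_iff_exists_pow, pow_apply_eq_of_agree h]

theorem cycleLength_congr {f g : Perm (Fin n)} {x : Fin n}
    (h : ∀ y, f.SameCycle x y ↔ g.SameCycle x y) : cycleLength f x = cycleLength g x := by
  simp only [cycleLength, h]

theorem cycleLength_eq_minimalPeriod (σ : Perm (Fin n)) (c : Fin n) :
    cycleLength σ c = Function.minimalPeriod σ c := by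
  have hpos : 0 < Function.minimalPeriod σ c :=
    Function.IsPeriodicPt.minimalPeriod_pos (orderOf_pos σ) (by
      rw [Function.IsPeriodicPt, Function.IsFixedPt, iterate_eq_pow, pow_orderOf_eq_one, one_apply])
  have h : Finset.univ.filter (fun d => σ.SameCycle c d) =
      (Finset.range (Function.minimalPeriod σ c)).image fun k => σ^[k] c := by
    ext d
    simp only [Finset.mem_filter, Finset.mem_univ, true_and, Finset.mem_image, Finset.mem_range,
      sameCycle_iff_exists_pow, ← iterate_eq_pow]
    refine ⟨fun ⟨k, hk⟩ => ⟨k % _, Nat.mod_lt _ hpos, ?_⟩, fun ⟨k, _, hk⟩ => ⟨k, hk⟩⟩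
    rw [Function.iterate_mod_minimalPeriod_eq, hk]
  rw [cycleLength, h, Finset.card_image_of_injOn, Finset.card_range]
  simpa using Function.iterate_injOn_Iio_minimalPeriod (f := σ) (x := c)

theorem cycleLength_pos (σ : Perm (Fin n)) (c : Fin n) : 0 < cycleLength σ c :=
  Finset.card_pos.2 ⟨c, by simp [SameCycle.rfl]⟩

theorem pow_cycleLength_apply (σ : Perm (Fin n)) (c : Fin n) : (σ ^ cycleLength σ c) c = c := by
  rw [cycleLength_eq_minimalPeriod, ← iterate_eq_pow, Function.iterate_minimalPeriod]

theorem pow_apply_ne_self {σ : Perm (Fin n)} {c : Fin n} {k : ℕ} (hk : 0 < k)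
    (hk' : k < cycleLength σ c) : (σ ^ k) c ≠ c := by
  rw [cycleLength_eq_minimalPeriod] at hk'
  intro h
  rw [← iterate_eq_pow] at h
  exact absurd (Function.IsPeriodicPt.minimalPeriod_le hk h) (by omega)

theorem cycleLength_eq_of_sameCycle {σ : Perm (Fin n)} {c d : Fin n} (h : σ.SameCycle c d) :
    cycleLength σ c = cycleLength σ d := by
  unfold cycleLength
  congr 1
  ext x
  simpa using ⟨fun hx => h.symm.trans hx, fun hx => h.trans hx⟩

end Cycles

/-! ### Products along a cycle -/

section CycleProducts

variable {n : ℕ} {R : Type*} [Ring R]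

theorem colCycleProd_eq_descProd (A : Matrix (Fin n) (Fin n) R) (τ : Perm (Fin n)) (c : Fin n) :
    colCycleProd A τ c =
      descProd (fun k => A ((τ ^ (k + 1)) c) ((τ ^ k) c)) (cycleLength τ c) := rfl

theorem colCycleProd_congr_of_agree (A : Matrix (Fin n) (Fin n) R) {f g : Perm (Fin n)} {x : Fin n}
    (h : ∀ y, g.SameCycle x y → f y = g y) : colCycleProd A f x = colCycleProd A g x := by
  simp only [colCycleProd, cycleLength_congr (sameCycle_iff_of_agree h), pow_apply_eq_of_agree h]

theorem colCycleProd_congr_matrix {A B : Matrix (Fin n) (Fin n) R} {τ : Perm (Fin n)} {c : Fin n}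
    (h : ∀ x y, τ.SameCycle c y → A x y = B x y) : colCycleProd A τ c = colCycleProd B τ c := by
  simp only [colCycleProd, h _ _ (sameCycle_pow_right.2 .rfl)]

theorem colCycleProd_inv (A : Matrix (Fin n) (Fin n) R) (τ : Perm (Fin n)) (c : Fin n) :
    colCycleProd A τ⁻¹ c = rowCycleProd A τ c := by
  have hlen : cycleLength τ⁻¹ c = cycleLength τ c := cycleLength_congr fun y => sameCycle_inv
  rw [colCycleProd_eq_descProd, rowCycleProd, prod_map_range_eq_descProd, hlen]
  have key : ∀ k ≤ cycleLength τ c, (τ⁻¹ ^ k) c = (τ ^ (cycleLength τ c - k)) c := by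
    intro k hk
    rw [inv_pow, inv_eq_iff_eq, ← mul_apply, ← pow_add, Nat.add_sub_cancel' hk,
      pow_cycleLength_apply]
  refine descProd_congr fun k hk => ?_
  rw [key _ hk, key _ hk.le]
  congr 3 <;> omega

theorem star_colCycleProd [StarRing R] {H : Matrix (Fin n) (Fin n) R} (hH : H.IsHermitian)
    (τ : Perm (Fin n)) (c : Fin n) : star (colCycleProd H τ c) = rowCycleProd H τ c := by
  simp only [colCycleProd_eq_descProd, star_descProd, hH.apply, rowCycleProd]

/-- The product of the factors of `colCycleProd A τ c` other than the last one, `A (τ c) c`; this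
is the path from `τ c` back to `c`. -/
def colPathProd (A : Matrix (Fin n) (Fin n) R) (τ : Perm (Fin n)) (c : Fin n) : R :=
  descProd (fun k => A ((τ ^ (k + 2)) c) ((τ ^ (k + 1)) c)) (cycleLength τ c - 1)

theorem colCycleProd_eq_colPathProd_mul (A : Matrix (Fin n) (Fin n) R) (τ : Perm (Fin n))
    (c : Fin n) : colCycleProd A τ c = colPathProd A τ c * A (τ c) c := by
  have h := descProd_succ' (fun k => A ((τ ^ (k + 1)) c) ((τ ^ k) c)) (cycleLength τ c - 1)
  rw [Nat.sub_add_cancel (cycleLength_pos τ c)] at h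
  exact h

theorem colCycleProd_apply_eq_mul_colPathProd (A : Matrix (Fin n) (Fin n) R) (τ : Perm (Fin n))
    (c : Fin n) : colCycleProd A τ (τ c) = A (τ c) c * colPathProd A τ c := by
  have h := descProd_succ (fun k => A ((τ ^ (k + 2)) c) ((τ ^ (k + 1)) c)) (cycleLength τ c - 1)
  have hp := Nat.sub_add_cancel (cycleLength_pos τ c)
  have e : cycleLength τ c - 1 + 2 = cycleLength τ c + 1 := by omega
  rw [e, hp, pow_succ', mul_apply, pow_cycleLength_apply] at h
  rw [colPathProd, ← h, colCycleProd_eq_descProd,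
    cycleLength_eq_of_sameCycle (c := τ c) (d := c) (sameCycle_apply_left.2 .rfl)]
  simp only [← mul_apply, ← pow_succ]

/-- Replacing the column `j` affects only the last factor of the product along the cycle of `j`. -/
theorem colCycleProd_updateCol_self (A : Matrix (Fin n) (Fin n) R) (τ : Perm (Fin n)) (j : Fin n)
    (b : Fin n → R) : colCycleProd (A.updateCol j b) τ j = colPathProd A τ j * b (τ j) := by
  rw [colCycleProd_eq_colPathProd_mul, Matrix.updateCol_self]
  congr 1
  exact descProd_congr fun k hk =>
    Matrix.updateCol_ne (pow_apply_ne_self k.succ_pos (by omega))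

theorem colCycleProd_updateCol_of_not_sameCycle (A : Matrix (Fin n) (Fin n) R) {τ : Perm (Fin n)}
    {c j : Fin n} (h : ¬ τ.SameCycle c j) (b : Fin n → R) :
    colCycleProd (A.updateCol j b) τ c = colCycleProd A τ c :=
  colCycleProd_congr_matrix fun _ _ hy => Matrix.updateCol_ne fun e => h (e ▸ hy)

end CycleProducts

/-! ### Reversing a cycle -/

section InvertCycle

variable {n : ℕ}

/-- The permutation that traverses the cycle of `d` backwards and agrees with `τ` elsewhere. -/
def invertCycle (d : Fin n) (τ : Perm (Fin n)) : Perm (Fin n) :=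
  τ * (τ.cycleOf d)⁻¹ * (τ.cycleOf d)⁻¹

theorem invertCycle_apply_of_sameCycle {d x : Fin n} {τ : Perm (Fin n)} (h : τ.SameCycle d x) :
    invertCycle d τ x = τ⁻¹ x := by
  have h1 : τ⁻¹.SameCycle d x := sameCycle_inv.2 h
  have h2 : τ⁻¹.SameCycle d (τ⁻¹ x) := sameCycle_apply_right.2 h1
  rw [invertCycle, cycleOf_inv, mul_apply, mul_apply, h1.cycleOf_apply, h2.cycleOf_apply]
  exact τ.apply_symm_apply _

theorem invertCycle_apply_of_not_sameCycle {d x : Fin n} {τ : Perm (Fin n)}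
    (h : ¬ τ.SameCycle d x) : invertCycle d τ x = τ x := by
  have h1 : ¬ τ⁻¹.SameCycle d x := fun h' => h (sameCycle_inv.1 h')
  rw [invertCycle, cycleOf_inv, mul_apply, mul_apply, cycleOf_apply_of_not_sameCycle h1,
    cycleOf_apply_of_not_sameCycle h1]

theorem invertCycle_agree_inv {d x : Fin n} {τ : Perm (Fin n)} (h : τ.SameCycle d x) (y : Fin n)
    (hy : τ⁻¹.SameCycle x y) : invertCycle d τ y = τ⁻¹ y :=
  invertCycle_apply_of_sameCycle (h.trans (sameCycle_inv.1 hy))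

theorem invertCycle_agree {d x : Fin n} {τ : Perm (Fin n)} (h : ¬ τ.SameCycle d x) (y : Fin n)
    (hy : τ.SameCycle x y) : invertCycle d τ y = τ y :=
  invertCycle_apply_of_not_sameCycle fun h' => h (h'.trans hy.symm)

theorem sameCycle_invertCycle {d x y : Fin n} {τ : Perm (Fin n)} :
    (invertCycle d τ).SameCycle x y ↔ τ.SameCycle x y := by
  by_cases h : τ.SameCycle d x
  · rw [sameCycle_iff_of_agree (invertCycle_agree_inv h), sameCycle_inv]
  · exact sameCycle_iff_of_agree (invertCycle_agree h) y

theorem invertCycle_invertCycle (d : Fin n) (τ : Perm (Fin n)) :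
    invertCycle d (invertCycle d τ) = τ := by
  ext1 x
  by_cases h : τ.SameCycle d x
  · rw [invertCycle_apply_of_sameCycle (sameCycle_invertCycle.2 h), inv_eq_iff_eq,
      invertCycle_apply_of_sameCycle (sameCycle_apply_right.2 h)]
    exact (τ.symm_apply_apply x).symm
  · rw [invertCycle_apply_of_not_sameCycle (mt sameCycle_invertCycle.1 h),
      invertCycle_apply_of_not_sameCycle h]

theorem sign_invertCycle (d : Fin n) (τ : Perm (Fin n)) : sign (invertCycle d τ) = sign τ := by
  rw [invertCycle, mul_assoc, Perm.sign_mul, Perm.sign_mul, Int.units_mul_self, mul_one]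

theorem colCycleProd_invertCycle_of_not_sameCycle {R : Type*} [Ring R]
    (A : Matrix (Fin n) (Fin n) R) {d c : Fin n} {τ : Perm (Fin n)} (h : ¬ τ.SameCycle d c) :
    colCycleProd A (invertCycle d τ) c = colCycleProd A τ c :=
  colCycleProd_congr_of_agree A (invertCycle_agree h)

/-- Reversing a cycle conjugates the product of the entries of a Hermitian matrix along it. -/
theorem colCycleProd_invertCycle {R : Type*} [Ring R] [StarRing R]
    {H : Matrix (Fin n) (Fin n) R} (hH : H.IsHermitian) {d c : Fin n} {τ : Perm (Fin n)}
    (h : τ.SameCycle d c) : colCycleProd H (invertCycle d τ) c = star (colCycleProd H τ c) := by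
  rw [colCycleProd_congr_of_agree H (invertCycle_agree_inv h), colCycleProd_inv,
    star_colCycleProd hH]

theorem openers_invertCycle (d j : Fin n) (τ : Perm (Fin n)) :
    openers (invertCycle d τ) j = openers τ j := by
  simp only [openers, sameCycle_invertCycle]

/-- If `p` does not change when the cycle of `d` is inverted, a sum over all permutations may be
replaced, on those that satisfy `p`, with its average over this inversion. -/
theorem sum_eq_sum_of_invertCycle {M : Type*} [AddCommGroup M] [Module ℝ M] (d : Fin n)
    (p : Perm (Fin n) → Prop) (hp : ∀ τ, p τ → p (invertCycle d τ)) (X Y : Perm (Fin n) → M)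
    (h₁ : ∀ τ, ¬ p τ → X τ = Y τ) (h₂ : ∀ τ, p τ → X τ + X (invertCycle d τ) = Y τ + Y τ) :
    ∑ τ, X τ = ∑ τ, Y τ := by
  classical
  let e : Perm (Fin n) → Perm (Fin n) := fun τ => if p τ then invertCycle d τ else τ
  have he : Function.Involutive e := by
    intro τ
    by_cases h : p τ
    · simp [e, h, hp τ h, invertCycle_invertCycle]
    · simp [e, h]
  have hsum : ∑ τ, X (e τ) = ∑ τ, X τ := Equiv.sum_comp (he.toPerm e) X
  have h2 : ∑ τ, X τ + ∑ τ, X τ = ∑ τ, Y τ + ∑ τ, Y τ := by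
    nth_rw 2 [← hsum]
    rw [← Finset.sum_add_distrib, ← Finset.sum_add_distrib]
    refine Finset.sum_congr rfl fun τ _ => ?_
    by_cases h : p τ
    · simp only [e, h, if_true, h₂ τ h]
    · simp only [e, h, if_false, h₁ τ h]
  rw [← two_smul ℝ, ← two_smul ℝ] at h2
  exact smul_right_injective M (two_ne_zero (α := ℝ)) h2

end InvertCycle

/-! ### Representatives of the cycles -/

section Leaders

variable {n : ℕ}

/-- Splitting off the cycle of `x` from a product over the smallest elements `c` of the cycles
on which `p` holds. -/
theorem prod_leaders_eq_mul {M : Type*} [CommMonoid M] (τ : Perm (Fin n)) (p : Fin n → Prop)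
    [DecidablePred p] (hp : ∀ x y, τ.SameCycle x y → p x → p y) (g : Fin n → M)
    (hg : ∀ x y, τ.SameCycle x y → g x = g y) {x : Fin n} (hx : p x) :
    ∏ c with p c ∧ ∀ d, τ.SameCycle c d → c ≤ d, g c =
      g x * ∏ c with (p c ∧ ¬ τ.SameCycle x c) ∧ ∀ d, τ.SameCycle c d → c ≤ d, g c := by
  obtain ⟨m, hxm, hm⟩ : ∃ m, τ.SameCycle x m ∧ ∀ d, τ.SameCycle m d → m ≤ d := by
    obtain ⟨m, hm, hmin⟩ := Finset.exists_min_image (Finset.univ.filter fun c => τ.SameCycle x c)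
      id ⟨x, by simp [SameCycle.rfl]⟩
    simp only [Finset.mem_filter, Finset.mem_univ, true_and, id] at hm hmin
    exact ⟨m, hm, fun d hd => hmin d (hm.trans hd)⟩
  have h : (Finset.univ.filter fun c => p c ∧ ∀ d, τ.SameCycle c d → c ≤ d) =
      insert m (Finset.univ.filter fun c =>
        (p c ∧ ¬ τ.SameCycle x c) ∧ ∀ d, τ.SameCycle c d → c ≤ d) := by
    ext c
    simp only [Finset.mem_filter, Finset.mem_univ, true_and, Finset.mem_insert]
    constructor
    · rintro ⟨hc, hlead⟩
      by_cases hxc : τ.SameCycle x c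
      · exact .inl (le_antisymm (hlead m (hxc.symm.trans hxm)) (hm c (hxm.symm.trans hxc)))
      · exact .inr ⟨⟨hc, hxc⟩, hlead⟩
    · rintro (rfl | ⟨⟨hc, -⟩, hlead⟩)
      · exact ⟨hp _ _ hxm hx, hm⟩
      · exact ⟨hc, hlead⟩
  rw [h, Finset.prod_insert (by simp [hxm]), hg x m hxm]

theorem nodup_openers (τ : Perm (Fin n)) (j : Fin n) : (openers τ j).Nodup := by
  refine List.nodup_cons.2 ⟨?_, (List.nodup_finRange n).filter _⟩
  simp [SameCycle.rfl]

theorem not_sameCycle_of_mem_openers {τ : Perm (Fin n)} {j c d : Fin n} (hc : c ∈ openers τ j)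
    (hd : d ∈ openers τ j) (hcd : c ≠ d) : ¬ τ.SameCycle c d := by
  simp only [openers, List.mem_cons, List.mem_filter, List.mem_finRange, true_and,
    decide_eq_true_eq] at hc hd
  rcases hc with rfl | ⟨hc, hc'⟩ <;> rcases hd with rfl | ⟨hd, hd'⟩
  · exact absurd rfl hcd
  · exact hd
  · exact fun h => hc h.symm
  · exact fun h => hcd (le_antisymm (hc' d h) (hd' c h.symm))

end Leaders

/-! ### Column determinants through real parts -/

section RealParts

variable {n : ℕ}

theorem add_star_eq_re_add_re (a : ℍ[ℝ]) : a + star a = (a.re : ℍ[ℝ]) + (a.re : ℍ[ℝ]) := by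
  rw [Quaternion.self_add_star', two_mul, Quaternion.coe_add]

/-- The product, over the cycles of `τ` that do not contain `j`, of the real parts of the products
of the entries of `H` along them. -/
noncomputable def outerProd (H : Matrix (Fin n) (Fin n) ℍ[ℝ]) (τ : Perm (Fin n)) (j : Fin n) : ℝ :=
  ∏ c with (¬ τ.SameCycle j c) ∧ ∀ d, τ.SameCycle c d → c ≤ d, (colCycleProd H τ c).re

/-- The monomial of `cdet j M` given by `τ`, without its sign, where the factors of the cycles
opened by the elements of `s` are replaced with their real parts. -/
noncomputable def semiRealMonomial (M : Matrix (Fin n) (Fin n) ℍ[ℝ]) (j : Fin n)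
    (s : Finset (Fin n)) (τ : Perm (Fin n)) : ℍ[ℝ] :=
  ((openers τ j).reverse.map fun c =>
    if c ∈ s then ((colCycleProd M τ c).re : ℍ[ℝ]) else colCycleProd M τ c).prod

/-- Averaging each term over the reversal of the cycle opened by `d` makes its factor real. The cycle
of `j` is excluded, since it meets the replaced column. -/
theorem sum_semiRealMonomial_insert {H : Matrix (Fin n) (Fin n) ℍ[ℝ]} (hH : H.IsHermitian)
    (j : Fin n) (b : Fin n → ℍ[ℝ]) {d : Fin n} {s : Finset (Fin n)} (hds : d ∉ s) (hdj : d ≠ j) :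
    ∑ τ : Perm (Fin n), ((sign τ : ℤ) : ℍ[ℝ]) * semiRealMonomial (H.updateCol j b) j s τ =
      ∑ τ : Perm (Fin n),
        ((sign τ : ℤ) : ℍ[ℝ]) * semiRealMonomial (H.updateCol j b) j (insert d s) τ := by
  set M := H.updateCol j b with hM
  refine sum_eq_sum_of_invertCycle d (fun τ => d ∈ openers τ j)
    (fun τ h => by rwa [openers_invertCycle]) _ _ (fun τ h => ?_) (fun τ h => ?_)
  · congr 1
    unfold semiRealMonomial
    congr 1
    refine List.map_congr_left fun c hc => ?_
    have hcd : c ≠ d := fun e => h (e ▸ List.mem_reverse.1 hc)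
    simp [hcd]
  · have hdj' : ¬ τ.SameCycle d j :=
      not_sameCycle_of_mem_openers h (List.mem_cons_self ..) hdj
    obtain ⟨l₁, l₂, hl⟩ := List.append_of_mem (List.mem_reverse.2 h)
    have hnd : (l₁ ++ d :: l₂).Nodup := hl ▸ List.nodup_reverse.2 (nodup_openers τ j)
    have hne : ∀ c ∈ l₁ ++ l₂, c ≠ d := by
      rw [List.nodup_middle, List.nodup_cons] at hnd
      exact fun c hc e => hnd.1 (e ▸ hc)
    have hother : ∀ c ∈ l₁ ++ l₂, colCycleProd M (invertCycle d τ) c = colCycleProd M τ c := by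
      intro c hc
      refine colCycleProd_invertCycle_of_not_sameCycle M
        (not_sameCycle_of_mem_openers h ?_ (hne c hc).symm)
      rw [← List.mem_reverse, hl]
      simp only [List.mem_append, List.mem_cons] at hc ⊢
      tauto
    have hself : colCycleProd M (invertCycle d τ) d = star (colCycleProd M τ d) := by
      rw [hM, colCycleProd_updateCol_of_not_sameCycle _ (mt sameCycle_invertCycle.1 hdj'),
        colCycleProd_updateCol_of_not_sameCycle _ hdj', colCycleProd_invertCycle hH .rfl]
    have hprod : ∀ (T T' : Fin n → ℍ[ℝ]), (∀ c ∈ l₁ ++ l₂, T c = T' c) →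
        ((l₁ ++ d :: l₂).map T).prod = (l₁.map T').prod * T d * (l₂.map T').prod := by
      intro T T' hT
      rw [List.map_append, List.map_cons, List.prod_append, List.prod_cons, mul_assoc,
        List.map_congr_left fun c hc => hT c (List.mem_append_left _ hc),
        List.map_congr_left fun c hc => hT c (List.mem_append_right _ hc)]
    simp only [semiRealMonomial, openers_invertCycle, sign_invertCycle, hl]
    rw [hprod (fun c => if c ∈ insert d s then ((colCycleProd M τ c).re : ℍ[ℝ])
        else colCycleProd M τ c) (fun c => if c ∈ s then ((colCycleProd M τ c).re : ℍ[ℝ])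
        else colCycleProd M τ c) (fun c hc => by simp [hne c hc]),
      hprod (fun c => if c ∈ s then ((colCycleProd M (invertCycle d τ) c).re : ℍ[ℝ])
        else colCycleProd M (invertCycle d τ) c) (fun c => if c ∈ s then
        ((colCycleProd M τ c).re : ℍ[ℝ]) else colCycleProd M τ c)
        (fun c hc => by rw [hother c hc]),
      hprod _ _ fun c _ => rfl]
    simp only [hds, if_false, hself, Finset.mem_insert_self, if_true]
    rw [← mul_add, ← add_mul, ← mul_add, add_star_eq_re_add_re, mul_add, add_mul, mul_add]

/-- When a column of a Hermitian matrix is replaced, the cycles that avoid this column contribute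
to the column determinant through the real parts of their products only: each of these cycles may be
reversed, which conjugates its product. -/
theorem cdet_updateCol_eq_sum {H : Matrix (Fin n) (Fin n) ℍ[ℝ]} (hH : H.IsHermitian)
    (j : Fin n) (b : Fin n → ℍ[ℝ]) :
    cdet j (H.updateCol j b) = ∑ τ : Perm (Fin n), ((sign τ : ℤ) : ℍ[ℝ]) *
      ((outerProd H τ j : ℍ[ℝ]) * colCycleProd (H.updateCol j b) τ j) := by
  have key : ∀ s : Finset (Fin n), j ∉ s → cdet j (H.updateCol j b) =
      ∑ τ : Perm (Fin n), ((sign τ : ℤ) : ℍ[ℝ]) * semiRealMonomial (H.updateCol j b) j s τ := by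
    intro s
    induction s using Finset.induction_on with
    | empty => simp [cdet, semiRealMonomial]
    | insert d s hds ih =>
      intro hj
      rw [Finset.mem_insert, not_or] at hj
      rw [ih hj.2, sum_semiRealMonomial_insert hH j b hds (Ne.symm hj.1)]
  rw [key (Finset.univ.erase j) (Finset.notMem_erase j _)]
  refine Finset.sum_congr rfl fun τ _ => ?_
  congr 1
  rw [semiRealMonomial, openers, List.reverse_cons, List.map_append, List.prod_append]
  simp only [List.map_cons, List.map_nil, List.prod_singleton, Finset.notMem_erase, if_false]
  congr 1
  rw [outerProd]
  have hL : (Finset.univ.filter fun c => (¬ τ.SameCycle j c) ∧ ∀ d, τ.SameCycle c d → c ≤ d) =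
      ((List.finRange n).filter fun c =>
        (¬ τ.SameCycle j c) ∧ ∀ d, τ.SameCycle c d → c ≤ d).toFinset := by
    ext c
    simp
  rw [hL, List.prod_toFinset _ ((List.nodup_finRange n).filter _), 
    ← (List.reverse_perm _).map _ |>.prod_eq, ← Quaternion.algebraMap_def, map_list_prod,
    List.map_map]
  congr 1
  refine List.map_congr_left fun c hc => ?_
  simp only [List.mem_reverse, List.mem_filter, List.mem_finRange, true_and,
    decide_eq_true_eq] at hc
  have hcj : c ≠ j := fun e => hc.1 (e ▸ .rfl)
  rw [if_pos (Finset.mem_erase.2 ⟨hcj, Finset.mem_univ c⟩),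
    colCycleProd_updateCol_of_not_sameCycle _ fun h => hc.1 h.symm]
  rfl

end RealParts

/-! ### Merging and splitting cycles by a transposition -/

section MulSwap

variable {n : ℕ}

theorem exists_pow_eq_of_sameCycle {σ : Perm (Fin n)} {c x : Fin n} (h : σ.SameCycle c x) :
    ∃ t, 0 < t ∧ t ≤ cycleLength σ c ∧ (σ ^ t) c = x := by
  obtain ⟨k, hk⟩ := sameCycle_iff_exists_pow.1 h
  have hmod : (σ ^ (k % cycleLength σ c)) c = x := by
    rw [← iterate_eq_pow, cycleLength_eq_minimalPeriod, Function.iterate_mod_minimalPeriod_eq,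
      iterate_eq_pow, hk]
  have hlt := Nat.mod_lt k (cycleLength_pos σ c)
  rcases Nat.eq_zero_or_pos (k % cycleLength σ c) with h0 | h0
  · exact ⟨_, cycleLength_pos σ c, le_rfl, by rw [pow_cycleLength_apply, ← hmod, h0, pow_zero,
      one_apply]⟩
  · exact ⟨_, h0, hlt.le, hmod⟩

theorem mul_swap_apply_of_ne {σ : Perm (Fin n)} {j k x : Fin n} (hj : x ≠ j) (hk : x ≠ k) :
    (σ * swap j k) x = σ x := by
  rw [mul_apply, swap_apply_of_ne_of_ne hj hk]

/-- After composing with the transposition, the orbit of `j` follows the `σ`-orbit of `k` until the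
latter first meets `j` or `k`. -/
theorem mul_swap_pow_apply_left {σ : Perm (Fin n)} {j k : Fin n} {m : ℕ}
    (hm : ∀ t, 0 < t → t < m → (σ ^ t) k ≠ j ∧ (σ ^ t) k ≠ k) {t : ℕ} (ht : 0 < t) (htm : t ≤ m) :
    ((σ * swap j k) ^ t) j = (σ ^ t) k := by
  induction t, ht using Nat.le_induction with
  | base => simp
  | succ t ht ih =>
    have h := hm t ht htm
    rw [pow_succ', mul_apply, ih (by omega), mul_swap_apply_of_ne h.1 h.2, ← mul_apply,
      ← pow_succ']

theorem mul_swap_pow_apply_right {σ : Perm (Fin n)} {j k : Fin n} {m : ℕ}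
    (hm : ∀ t, 0 < t → t < m → (σ ^ t) j ≠ j ∧ (σ ^ t) j ≠ k) {t : ℕ} (ht : 0 < t) (htm : t ≤ m) :
    ((σ * swap j k) ^ t) k = (σ ^ t) j := by
  rw [swap_comm]
  exact mul_swap_pow_apply_left (fun t h h' => (hm t h h').symm) ht htm

/-- Composing with the transposition of `j` and `k` merges the cycles of `j` and `k`. -/
theorem sameCycle_mul_swap_left_iff {σ : Perm (Fin n)} {j k : Fin n} (h : ¬ σ.SameCycle j k)
    (x : Fin n) :
    (σ * swap j k).SameCycle j x ↔ σ.SameCycle j x ∨ σ.SameCycle k x := by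
  have hjk : ∀ t, 0 < t → t < cycleLength σ k → (σ ^ t) k ≠ j ∧ (σ ^ t) k ≠ k := fun t h0 ht =>
    ⟨fun e => h (sameCycle_iff_exists_pow.2 ⟨t, e⟩).symm, pow_apply_ne_self h0 ht⟩
  have hkj : ∀ t, 0 < t → t < cycleLength σ j → (σ ^ t) j ≠ j ∧ (σ ^ t) j ≠ k := fun t h0 ht =>
    ⟨pow_apply_ne_self h0 ht, fun e => h (sameCycle_iff_exists_pow.2 ⟨t, e⟩)⟩
  have hk : (σ * swap j k).SameCycle j k := sameCycle_iff_exists_pow.2 ⟨cycleLength σ k, by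
    rw [mul_swap_pow_apply_left hjk (cycleLength_pos σ k) le_rfl, pow_cycleLength_apply]⟩
  constructor
  · intro hx
    obtain ⟨m, rfl⟩ := sameCycle_iff_exists_pow.1 hx
    clear hx
    induction m with
    | zero => exact .inl .rfl
    | succ m ih =>
      rw [pow_succ', mul_apply]
      generalize ((σ * swap j k) ^ m) j = y at ih ⊢
      by_cases hyj : y = j
      · subst hyj
        exact .inr (by rw [mul_apply, swap_apply_left]; exact sameCycle_apply_right.2 .rfl)
      by_cases hyk : y = k
      · subst hyk
        exact .inl (by rw [mul_apply, swap_apply_right]; exact sameCycle_apply_right.2 .rfl)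
      rwa [mul_swap_apply_of_ne hyj hyk, sameCycle_apply_right, sameCycle_apply_right]
  · rintro (hx | hx) <;> obtain ⟨t, h0, ht, rfl⟩ := exists_pow_eq_of_sameCycle hx
    · rw [← mul_swap_pow_apply_right hkj h0 ht]
      exact sameCycle_pow_right.2 hk
    · rw [← mul_swap_pow_apply_left hjk h0 ht]
      exact sameCycle_pow_right.2 .rfl

theorem mul_swap_agree {σ : Perm (Fin n)} {j k c : Fin n} (hj : ¬ σ.SameCycle j c)
    (hk : ¬ σ.SameCycle k c) (y : Fin n) (hy : σ.SameCycle c y) : (σ * swap j k) y = σ y :=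
  mul_swap_apply_of_ne (fun e => hj (e ▸ hy.symm)) (fun e => hk (e ▸ hy.symm))

/-- Composing with the transposition of `j` and `k` splits a cycle that contains both. -/
theorem not_sameCycle_mul_swap {σ : Perm (Fin n)} {j k : Fin n} (hjk : j ≠ k)
    (h : σ.SameCycle j k) : ¬ (σ * swap j k).SameCycle j k := by
  classical
  have hex : ∃ a, 0 < a ∧ (σ ^ a) j = k :=
    let ⟨t, h0, _, ht⟩ := exists_pow_eq_of_sameCycle h
    ⟨t, h0, ht⟩
  obtain ⟨ha, hak⟩ := Nat.find_spec hex
  set a := Nat.find hex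
  have hmin : ∀ t, 0 < t → t < a → (σ ^ t) j ≠ k := fun t h0 ht e =>
    Nat.find_min hex ht ⟨h0, e⟩
  have hne : ∀ t, 0 < t → t < a → (σ ^ t) j ≠ j ∧ (σ ^ t) j ≠ k := by
    refine fun t h0 ht => ⟨fun e => hmin (a - t) (by omega) (by omega) ?_, hmin t h0 ht⟩
    nth_rw 1 [← e]
    rw [← mul_apply, ← pow_add, Nat.sub_add_cancel ht.le, hak]
  -- The elements `σ j, …, σ ^ a j = k` form the whole cycle of `k` for the composition.
  have hcycle : ∀ m, ∃ t, 0 < t ∧ t ≤ a ∧ ((σ * swap j k) ^ m) k = (σ ^ t) j := by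
    intro m
    induction m with
    | zero => exact ⟨a, ha, le_rfl, by simp [hak]⟩
    | succ m ih =>
      obtain ⟨t, h0, hta, ht⟩ := ih
      rw [pow_succ', mul_apply, ht]
      rcases hta.eq_or_lt with rfl | hlt
      · exact ⟨1, Nat.one_pos, ha, by rw [hak, mul_apply, swap_apply_right, pow_one]⟩
      · exact ⟨t + 1, t.succ_pos, hlt, by
          rw [mul_swap_apply_of_ne (hne t h0 hlt).1 (hne t h0 hlt).2, pow_succ', mul_apply]⟩
  intro hs
  obtain ⟨m, hm⟩ := sameCycle_iff_exists_pow.1 hs.symm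
  obtain ⟨t, h0, hta, ht⟩ := hcycle m
  rw [hm] at ht
  rcases hta.eq_or_lt with rfl | hlt
  · exact hjk (ht.trans hak)
  · exact (hne t h0 hlt).1 ht.symm

theorem sameCycle_mul_swap_iff {σ : Perm (Fin n)} {j k : Fin n} (hjk : j ≠ k) :
    (σ * swap j k).SameCycle j k ↔ ¬ σ.SameCycle j k :=
  ⟨fun h h' => not_sameCycle_mul_swap hjk h' h,
    fun h => (sameCycle_mul_swap_left_iff h k).2 (.inr .rfl)⟩

theorem cycleLength_mul_swap {σ : Perm (Fin n)} {j k : Fin n} (h : ¬ σ.SameCycle j k) :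
    cycleLength (σ * swap j k) j = cycleLength σ k + cycleLength σ j := by
  simp only [cycleLength, sameCycle_mul_swap_left_iff h]
  rw [Finset.filter_or, Finset.card_union_of_disjoint, add_comm]
  exact Finset.disjoint_filter.2 fun x _ hx hx' => h (hx.trans hx'.symm)

/-- When the column `j` is a copy of the column `k` and `k` is not in the cycle of `j`, merging the
two cycles concatenates their products. -/
theorem colCycleProd_updateCol_mul_swap {R : Type*} [Ring R] (A : Matrix (Fin n) (Fin n) R)
    {σ : Perm (Fin n)} {j k : Fin n} (h : ¬ σ.SameCycle j k) :
    colCycleProd (A.updateCol j fun i => A i k) (σ * swap j k) j =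
      colCycleProd (A.updateCol j fun i => A i k) σ j * colCycleProd A σ k := by
  set M := A.updateCol j fun i => A i k
  have hMj : ∀ x, M x j = A x k := fun x => Matrix.updateCol_self
  have hM : ∀ x y, y ≠ j → M x y = A x y := fun x y hy => Matrix.updateCol_ne hy
  have hkj : k ≠ j := fun e => h (e ▸ .rfl)
  have hne : ∀ t, (σ ^ t) k ≠ j := fun t e => h (sameCycle_iff_exists_pow.2 ⟨t, e⟩).symm
  -- The merged cycle starts at `j`, runs through the old cycle of `k`, then from `k` through that
  -- of `j`.
  have hpow₁ : ∀ t, 0 < t → t ≤ cycleLength σ k → ((σ * swap j k) ^ t) j = (σ ^ t) k :=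
    fun t => mul_swap_pow_apply_left fun t h0 ht => ⟨hne t, pow_apply_ne_self h0 ht⟩
  have hpow₂ : ∀ t, 0 < t → t ≤ cycleLength σ j → ((σ * swap j k) ^ t) k = (σ ^ t) j :=
    fun t => mul_swap_pow_apply_right fun t h0 ht =>
      ⟨pow_apply_ne_self h0 ht, fun e => h (sameCycle_iff_exists_pow.2 ⟨t, e⟩)⟩
  have hk : ((σ * swap j k) ^ cycleLength σ k) j = k := by
    rw [hpow₁ _ (cycleLength_pos σ k) le_rfl, pow_cycleLength_apply]
  have hadd : ∀ t, ((σ * swap j k) ^ (cycleLength σ k + t)) j = ((σ * swap j k) ^ t) k := by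
    intro t
    rw [add_comm, pow_add, mul_apply, hk]
  rw [colCycleProd_eq_descProd, cycleLength_mul_swap h, descProd_add, colCycleProd_eq_descProd,
    colCycleProd_eq_descProd]
  congr 1
  · refine descProd_congr fun t ht => ?_
    rw [add_assoc, hadd, hadd, hpow₂ _ t.succ_pos ht]
    rcases Nat.eq_zero_or_pos t with rfl | h0
    · rw [pow_zero, pow_zero, one_apply, one_apply, hMj, hM _ _ hkj]
    · rw [hpow₂ t h0 ht.le]
  · refine descProd_congr fun t ht => ?_
    rw [hpow₁ _ t.succ_pos ht]
    rcases Nat.eq_zero_or_pos t with rfl | h0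
    · rw [pow_zero, pow_zero, one_apply, one_apply, hMj]
    · rw [hpow₁ t h0 ht.le, hM _ _ (hne t)]

end MulSwap

/-! ### Determinants of Hermitian matrices and Cramer's rule -/

section Hermitian

variable {n : ℕ}

/-- Changing the element that opens a cycle permutes the factors cyclically, and
`re (a * b) = re (b * a)`. -/
theorem re_colCycleProd_eq_of_sameCycle (A : Matrix (Fin n) (Fin n) ℍ[ℝ]) {τ : Perm (Fin n)}
    {x y : Fin n} (h : τ.SameCycle x y) : (colCycleProd A τ x).re = (colCycleProd A τ y).re := by
  obtain ⟨m, rfl⟩ := sameCycle_iff_exists_pow.1 h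
  clear h
  induction m with
  | zero => rfl
  | succ m ih =>
    rw [ih, pow_succ', mul_apply, colCycleProd_apply_eq_mul_colPathProd,
      colCycleProd_eq_colPathProd_mul, Quaternion.re_mul, Quaternion.re_mul]
    ring

theorem re_colCycleProd_invertCycle {H : Matrix (Fin n) (Fin n) ℍ[ℝ]} (hH : H.IsHermitian)
    (d c : Fin n) (τ : Perm (Fin n)) :
    (colCycleProd H (invertCycle d τ) c).re = (colCycleProd H τ c).re := by
  by_cases h : τ.SameCycle d c
  · rw [colCycleProd_invertCycle hH h, Quaternion.re_star]
  · rw [colCycleProd_invertCycle_of_not_sameCycle H h]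

theorem outerProd_invertCycle {H : Matrix (Fin n) (Fin n) ℍ[ℝ]} (hH : H.IsHermitian)
    (d j : Fin n) (τ : Perm (Fin n)) :
    outerProd H (invertCycle d τ) j = outerProd H τ j := by
  simp only [outerProd, sameCycle_invertCycle, re_colCycleProd_invertCycle hH]

/-- The product, over the cycles of `τ` that contain neither `j` nor `k`, of the real parts of the
products of the entries of `H` along them. -/
noncomputable def outerProd₂ (H : Matrix (Fin n) (Fin n) ℍ[ℝ]) (τ : Perm (Fin n)) (j k : Fin n) :
    ℝ :=
  ∏ c with ((¬ τ.SameCycle j c) ∧ ¬ τ.SameCycle k c) ∧ ∀ d, τ.SameCycle c d → c ≤ d,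
    (colCycleProd H τ c).re

theorem outerProd₂_invertCycle {H : Matrix (Fin n) (Fin n) ℍ[ℝ]} (hH : H.IsHermitian)
    (d j k : Fin n) (τ : Perm (Fin n)) :
    outerProd₂ H (invertCycle d τ) j k = outerProd₂ H τ j k := by
  simp only [outerProd₂, sameCycle_invertCycle, re_colCycleProd_invertCycle hH]

theorem outerProd_eq_re_mul_outerProd₂ (H : Matrix (Fin n) (Fin n) ℍ[ℝ]) {τ : Perm (Fin n)}
    {j k : Fin n} (h : ¬ τ.SameCycle j k) :
    outerProd H τ j = (colCycleProd H τ k).re * outerProd₂ H τ j k :=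
  prod_leaders_eq_mul τ (fun c => ¬ τ.SameCycle j c) (fun _ _ hxy hx hy => hx (hy.trans hxy.symm))
    _ (fun _ _ => re_colCycleProd_eq_of_sameCycle H) h

theorem outerProd_mul_swap (H : Matrix (Fin n) (Fin n) ℍ[ℝ]) {σ : Perm (Fin n)}
    {j k : Fin n} (h : ¬ σ.SameCycle j k) :
    outerProd H (σ * swap j k) j = outerProd₂ H σ j k := by
  have hiff : ∀ c, (¬ (σ * swap j k).SameCycle j c) ↔
      (¬ σ.SameCycle j c) ∧ ¬ σ.SameCycle k c := fun c => by
    rw [sameCycle_mul_swap_left_iff h, not_or]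
  rw [outerProd, outerProd₂]
  refine Finset.prod_congr (Finset.filter_congr fun c _ => ?_) fun c hc => ?_
  · rw [hiff]
    refine and_congr_right fun hc => ?_
    simp only [sameCycle_iff_of_agree (mul_swap_agree hc.1 hc.2)]
  · have hc' := (Finset.mem_filter.1 hc).2.1
    rw [colCycleProd_congr_of_agree H (mul_swap_agree hc'.1 hc'.2)]

/-- The determinant of a Hermitian matrix as a real number: the signed sum, over all permutations,
of the products of the real parts of the products of the entries along the cycles. -/
noncomputable def realDet (H : Matrix (Fin n) (Fin n) ℍ[ℝ]) : ℝ :=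
  ∑ τ : Perm (Fin n), ((sign τ : ℤ) : ℝ) *
    ∏ c with ∀ d, τ.SameCycle c d → c ≤ d, (colCycleProd H τ c).re

theorem cdet_eq_realDet {H : Matrix (Fin n) (Fin n) ℍ[ℝ]} (hH : H.IsHermitian) (j : Fin n) :
    cdet j H = (realDet H : ℍ[ℝ]) := by
  have hself : H.updateCol j (fun i => H i j) = H := Matrix.updateCol_eq_self H j
  have h := cdet_updateCol_eq_sum hH j fun i => H i j
  rw [hself] at h
  have havg : ∑ τ : Perm (Fin n), ((sign τ : ℤ) : ℍ[ℝ]) *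
        ((outerProd H τ j : ℍ[ℝ]) * colCycleProd H τ j) =
      ∑ τ : Perm (Fin n), ((sign τ : ℤ) : ℍ[ℝ]) *
        ((outerProd H τ j : ℍ[ℝ]) * ((colCycleProd H τ j).re : ℍ[ℝ])) := by
    refine sum_eq_sum_of_invertCycle j (fun _ => True) (fun _ h => h) _ _
      (fun τ h => absurd trivial h) fun τ _ => ?_
    rw [sign_invertCycle, outerProd_invertCycle hH, colCycleProd_invertCycle hH .rfl, ← mul_add,
      ← mul_add, add_star_eq_re_add_re, mul_add, mul_add]
  rw [h, havg, realDet, ← Quaternion.algebraMap_def, map_sum]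
  refine Finset.sum_congr rfl fun τ _ => ?_
  have hsplit := prod_leaders_eq_mul τ (fun _ => True) (fun _ _ _ h => h)
    (fun c => (colCycleProd H τ c).re) (fun _ _ => re_colCycleProd_eq_of_sameCycle H)
    (x := j) trivial
  simp only [true_and] at hsplit
  rw [hsplit, map_mul, map_intCast, mul_comm (colCycleProd H τ j).re, map_mul]
  rfl

theorem rdet_eq_realDet {H : Matrix (Fin n) (Fin n) ℍ[ℝ]} (hH : H.IsHermitian) (i : Fin n) :
    rdet i H = (realDet H : ℍ[ℝ]) := by
  have h : rdet i H = star (cdet i H) := by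
    rw [rdet, cdet, star_sum]
    refine Finset.sum_congr rfl fun τ _ => ?_
    rw [star_mul, star_intCast, ← Int.cast_comm]
    congr 1
    generalize openers τ i = l
    induction l with
    | nil => simp
    | cons c l ih => simp [ih, star_colCycleProd hH]
  rw [h, cdet_eq_realDet hH, Quaternion.star_coe]

/-- The column determinant of a Hermitian matrix vanishes when a column is replaced with a copy of
another one: the terms where `j` and `k` share a cycle cancel those where they do not. -/
theorem cdet_updateCol_eq_zero {H : Matrix (Fin n) (Fin n) ℍ[ℝ]} (hH : H.IsHermitian)
    {j k : Fin n} (hjk : j ≠ k) : cdet j (H.updateCol j fun i => H i k) = 0 := by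
  rw [cdet_updateCol_eq_sum hH]
  set M := H.updateCol j fun i => H i k
  -- `X` collects the merged terms up to sign, `Y` the terms where `j` and `k` are separated.
  let X : Perm (Fin n) → ℍ[ℝ] := fun σ => if σ.SameCycle j k then 0 else
    ((sign σ : ℤ) : ℍ[ℝ]) * ((outerProd₂ H σ j k : ℍ[ℝ]) *
      (colCycleProd M σ j * colCycleProd H σ k))
  let Y : Perm (Fin n) → ℍ[ℝ] := fun σ => if σ.SameCycle j k then 0 else
    ((sign σ : ℤ) : ℍ[ℝ]) * ((outerProd H σ j : ℍ[ℝ]) * colCycleProd M σ j)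
  have hXY : ∑ σ, X σ = ∑ σ, Y σ := by
    refine sum_eq_sum_of_invertCycle k (fun σ => ¬ σ.SameCycle j k)
      (fun σ h => mt sameCycle_invertCycle.1 h) X Y (fun σ h => ?_) fun σ h => ?_
    · simp only [X, Y, if_pos (not_not.1 h)]
    · have hkj : ¬ σ.SameCycle k j := fun h' => h h'.symm
      simp only [X, Y, sameCycle_invertCycle, if_neg h, sign_invertCycle,
        outerProd₂_invertCycle hH, colCycleProd_invertCycle_of_not_sameCycle M hkj,
        colCycleProd_invertCycle hH (SameCycle.refl σ k)]
      rw [← mul_add, ← mul_add, ← mul_add, add_star_eq_re_add_re,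
        outerProd_eq_re_mul_outerProd₂ H h, mul_add, mul_add, mul_add, Quaternion.coe_mul,
        ← Quaternion.coe_commutes, ← mul_assoc (outerProd₂ H σ j k : ℍ[ℝ]),
        Quaternion.coe_commutes (outerProd₂ H σ j k)]
  have hterm : ∀ σ : Perm (Fin n), ((sign σ : ℤ) : ℍ[ℝ]) *
      ((outerProd H σ j : ℍ[ℝ]) * colCycleProd M σ j) = Y σ - X (σ * swap j k) := by
    intro σ
    by_cases h : σ.SameCycle j k
    · have h' := not_sameCycle_mul_swap hjk h
      have hσ : σ = σ * swap j k * swap j k := by rw [mul_assoc, swap_mul_self, mul_one]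
      simp only [X, Y, if_pos h, if_neg h']
      rw [← outerProd_mul_swap H h', ← colCycleProd_updateCol_mul_swap H h', ← hσ,
        Perm.sign_mul, sign_swap hjk]
      simp [M]
    · have h' := (sameCycle_mul_swap_iff hjk).2 h
      simp only [X, Y, if_neg h, if_pos h', sub_zero]
  rw [Finset.sum_congr rfl fun σ _ => hterm σ, Finset.sum_sub_distrib, ← hXY, sub_eq_zero]
  exact (Equiv.sum_comp (Equiv.mulRight (swap j k)) X).symm

/-- Right linearity of the column determinant in the column that opens its first cycle. -/
theorem cdet_updateCol_mulVec {H : Matrix (Fin n) (Fin n) ℍ[ℝ]} (hH : H.IsHermitian) (j : Fin n)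
    (B : Matrix (Fin n) (Fin n) ℍ[ℝ]) (x : Fin n → ℍ[ℝ]) :
    cdet j (H.updateCol j (B *ᵥ x)) = ∑ k, cdet j (H.updateCol j fun i => B i k) * x k := by
  simp only [cdet_updateCol_eq_sum hH, colCycleProd_updateCol_self, Matrix.mulVec, dotProduct,
    Finset.sum_mul, Finset.mul_sum, mul_assoc]
  exact Finset.sum_comm

/-- Cramer's rule for a Hermitian matrix, free of division. -/
theorem cdet_updateCol_mulVec_self {H : Matrix (Fin n) (Fin n) ℍ[ℝ]} (hH : H.IsHermitian)
    (x : Fin n → ℍ[ℝ]) (j : Fin n) :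
    cdet j (H.updateCol j (H *ᵥ x)) = (realDet H : ℍ[ℝ]) * x j := by
  rw [cdet_updateCol_mulVec hH, Finset.sum_eq_single j]
  · rw [← cdet_eq_realDet hH j]
    congr 2
    exact Matrix.updateCol_eq_self H j
  · intro k _ hkj
    rw [cdet_updateCol_eq_zero hH hkj.symm, zero_mul]
  · simp

theorem ddet_eq_realDet [NeZero n] (A : Matrix (Fin n) (Fin n) ℍ[ℝ]) :
    ddet A = (realDet (Aᴴ * A) : ℍ[ℝ]) :=
  rdet_eq_realDet (Matrix.isHermitian_conjTranspose_mul_self A) 0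

/-- The cofactors of `Aᴴ * A`, divided by `ddet A`, form a left inverse of `Aᴴ * A`, so `A` has a
left inverse; over a division ring this is also a right inverse. -/
theorem exists_mul_eq_one_of_ddet_ne_zero [NeZero n] {A : Matrix (Fin n) (Fin n) ℍ[ℝ]}
    (hA : ddet A ≠ 0) : ∃ B : Matrix (Fin n) (Fin n) ℍ[ℝ], A * B = 1 := by
  have hH := Matrix.isHermitian_conjTranspose_mul_self A
  rw [ddet_eq_realDet] at hA
  set H := Aᴴ * A with hHdef
  let C : Matrix (Fin n) (Fin n) ℍ[ℝ] := Matrix.of fun j i =>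
    cdet j (H.updateCol j fun l => (1 : Matrix (Fin n) (Fin n) ℍ[ℝ]) l i)
  have hC : C * H = (realDet H : ℍ[ℝ]) • 1 := by
    refine Matrix.ext_of_mulVec_single fun i => funext fun j => ?_
    have h := cdet_updateCol_mulVec hH j 1 (H *ᵥ Pi.single i 1)
    rw [Matrix.one_mulVec, cdet_updateCol_mulVec_self hH] at h
    rw [← Matrix.mulVec_mulVec, Matrix.smul_mulVec, Matrix.one_mulVec]
    exact h.symm
  refine ⟨(realDet H : ℍ[ℝ])⁻¹ • (C * Aᴴ), mul_eq_one_comm.1 ?_⟩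
  rw [Matrix.smul_mul, Matrix.mul_assoc, ← hHdef, hC, smul_smul, inv_mul_cancel₀ hA, one_smul]

end Hermitian

end QuaternionCramer

theorem theorem2p11 (n : ℕ) [NeZero n] (A : Matrix (Fin n) (Fin n) ℍ[ℝ])
    (hA : QuaternionCramer.ddet A ≠ 0) (x y : Fin n → ℍ[ℝ]) :
    A *ᵥ x = y ↔
      ∀ j : Fin n,
        x j = QuaternionCramer.cdet j ((Aᴴ * A).updateCol j (Aᴴ *ᵥ y)) / QuaternionCramer.ddet A := by
  have cramer : ∀ z : Fin n → ℍ[ℝ], A *ᵥ z = y → ∀ j, z j = QuaternionCramer.cdet j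
      ((Aᴴ * A).updateCol j (Aᴴ *ᵥ y)) / QuaternionCramer.ddet A := by
    rintro z rfl j
    rw [eq_div_iff hA, Matrix.mulVec_mulVec, QuaternionCramer.cdet_updateCol_mulVec_self
      (Matrix.isHermitian_conjTranspose_mul_self A), QuaternionCramer.ddet_eq_realDet,
      Quaternion.coe_commutes]
  refine ⟨cramer x, fun hx => ?_⟩
  obtain ⟨B, hB⟩ := QuaternionCramer.exists_mul_eq_one_of_ddet_ne_zero hA
  have hy : A *ᵥ (B *ᵥ y) = y := by rw [Matrix.mulVec_mulVec, hB, Matrix.one_mulVec]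
  have hxB : x = B *ᵥ y := funext fun j => (hx j).trans (cramer _ hy j).symm
  rw [hxB, hy]
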